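/- Let $d, N \ge 1$ be integers and let $T_1,\dots,T_N:\mathbb{R}^d\to\mathbb{R}^d$ be linear similarities, that is, linear maps with $|T_i(x)-T_i(y)| = \mathrm{Lip}(T_i)\,|x-y|$ for all $x,y\in\mathbb{R}^d$, whose Lipschitz constants satisfy $0<\mathrm{Lip}(T_i)<1/2$ for all $i$. Let $C\subset\mathbb{R}^d$ be a non-empty compact set. For every $\mathbf{t}=(t_1,\dots,t_N)\in(\mathbb{R}^d)^N$ there are a unique non-empty compact set $F_{\mathbf{t},\emptyset}$ and a unique non-empty compact set $F_{\mathbf{t},C}$ satisfying $$F_{\mathbf{t},\emptyset}=\bigcup_{i=1}^N\big(T_i(F_{\mathbf{t},\emptyset})+t_i\big),\qquad F_{\mathbf{t},C}=\bigcup_{i=1}^N\big(T_i(F_{\mathbf{t},C})+t_i\big)\cup C.$$ For a non-empty bounded set $F\subset\mathbb{R}^d$ and $\delta>0$ let $N_\delta(F)$ be the minimum number of sets of diameter at most $\delta$ required to cover $F$, and let $$\overline{\dim}_{\mathrm B}F=\limsup_{\delta\to0^+}\frac{\log N_\delta(F)}{-\log\delta}$$ be the upper box dimension of $F$. Then, for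 $\mathcal{L}^{dN}$-almost all $\mathbf{t}\in(\mathbb{R}^d)^N$, where $\mathcal{L}^{dN}$ is the $N$-fold product of $d$-dimensional Lebesgue measure, $$\overline{\dim}_{\mathrm B}F_{\mathbf{t},C}=\max\big\{\overline{\dim}_{\mathrm B}F_{\mathbf{t},\emptyset},\ \overline{\dim}_{\mathrm B}C\big\}.$$ -/

import Mathlib

open Set Filter Topology MeasureTheory
open scoped ENNReal

/-- `S` is a contracting similarity whose Lipschitz constant is `c ∈ (0, 1)`. -/
def IsContractingSimilarity {X : Type*} [MetricSpace X] (S : X → X) (c : ℝ) : Prop :=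
  0 < c ∧ c < 1 ∧ ∀ x y : X, dist (S x) (S y) = c * dist x y

/-- `F` is an attractor of the iterated function system `S 1, …, S N` with condensation set `C`:
a non-empty compact set with `F = S 1 (F) ∪ ⋯ ∪ S N (F) ∪ C`.
The case `C = ∅` is that of the homogeneous attractor. -/
def IsAttractor {X : Type*} [MetricSpace X] {N : ℕ} (S : Fin N → X → X) (C F : Set X) : Prop :=
  F.Nonempty ∧ IsCompact F ∧ F = (⋃ i, S i '' F) ∪ C

/-- `N_δ(F)`: the minimum number of sets of diameter at most `δ` required to cover `F`
(`⊤` if no finite number suffices). -/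
noncomputable def boxCoveringNumber {X : Type*} [MetricSpace X] (δ : ℝ) (F : Set X) : ℕ∞ :=
  ⨅ (𝒰 : Set (Set X)) (_ : F ⊆ ⋃₀ 𝒰) (_ : ∀ U ∈ 𝒰, Metric.ediam U ≤ ENNReal.ofReal δ), 𝒰.encard

/-- The upper box dimension `limsup_{δ → 0+} log N_δ(F) / (- log δ)`,
as an extended real number. -/
noncomputable def upperBoxDim {X : Type*} [MetricSpace X] (F : Set X) : EReal :=
  limsup (fun δ : ℝ => ENNReal.log (boxCoveringNumber δ F : ℝ≥0∞) / ((-Real.log δ : ℝ) : EReal))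
    (𝓝[>] (0 : ℝ))

/-! Let `s` be the similarity dimension, `∑ c i ^ s = 1`. The inequality `≥` holds for every `t`,
since both `F₀` and `C` lie in `F`. For `≤`, two upper bounds on `dim F` are available for every
`t`: it is at most the ambient dimension `d`, and at most any `u ≥ 0` with `∑ c i ^ u < 1` and `dim
C < u`, by iterating `N_δ(F) ≤ ∑ N_{δ/c i}(F) + N_δ(C)` (`upperBoxDim_le_of_subset_iUnion`). Both
are absorbed by the maximum once `dim F₀ ≥ min s d`, and this is the only place where almost every
`t` enters (`ae_le_upperBoxDim`).

The bound on `dim F₀` is a second-moment argument. Give a word `w` of length `n` the weight `∏ c (w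
k) ^ s` and attach to it a point `x_w(t)` within `O(a ^ n)` of `F₀`, where `a = max c i`. By
Cauchy–Schwarz, a cover of `F₀` at scale `a ^ n` needs at least as many sets as the inverse of the
probability that two independent random words have points within `K * a ^ n`. Since `a < 1/2`, `x_w
- x_v` is non-degenerate in one translation vector whenever `w` and `v` differ in the first letter,
so such a pair is `r`-close only for `t` in a set of measure `O(r ^ d)` in a given ball. Stripping
common first letters bounds the mean collision probability by `O(n * a ^ (n * m))` with `m = min s
d`, and a Borel–Cantelli argument makes this almost sure up to an arbitrarily small loss in the
exponent. -/

/-! ### Existence, uniqueness and comparison of attractors. -/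

section Attractor

variable {X : Type*} [MetricSpace X]

/-- A compact set contained in its image under the set map of an iterated function system with
condensation is contained in every non-empty closed set that the set map sends into itself. -/
theorem subset_of_subset_hutchinson {ι : Type*} {S : ι → X → X} {a : ℝ} (ha0 : 0 ≤ a)
    (ha : a < 1) (hS : ∀ i x y, dist (S i x) (S i y) ≤ a * dist x y) {C F G : Set X}
    (hF : IsCompact F) (hFS : F ⊆ (⋃ i, S i '' F) ∪ C)
    (hG : IsClosed G) (hG' : G.Nonempty) (hGS : (⋃ i, S i '' G) ∪ C ⊆ G) : F ⊆ G := by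
  rcases F.eq_empty_or_nonempty with rfl | hne
  · exact empty_subset _
  obtain ⟨x, hx, hmax⟩ := hF.exists_isMaxOn hne (Metric.continuous_infDist_pt G).continuousOn
  -- The largest distance from a point of `F` to `G` is at most `a` times itself, hence zero.
  have key : Metric.infDist x G ≤ a * Metric.infDist x G := by
    rcases hFS hx with h | h
    · obtain ⟨i, y, hy, rfl⟩ := mem_iUnion.1 h
      refine le_trans ?_ (mul_le_mul_of_nonneg_left (hmax hy) ha0)
      refine le_of_forall_pos_le_add fun ε hε => ?_
      obtain ⟨z, hz, hyz⟩ := (Metric.infDist_lt_iff hG').1 (lt_add_of_pos_right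
        (Metric.infDist y G) hε)
      have hz' : S i z ∈ G := hGS (Or.inl (mem_iUnion.2 ⟨i, z, hz, rfl⟩))
      calc Metric.infDist (S i y) G ≤ dist (S i y) (S i z) := Metric.infDist_le_dist_of_mem hz'
        _ ≤ a * dist y z := hS i y z
        _ ≤ a * (Metric.infDist y G + ε) := mul_le_mul_of_nonneg_left hyz.le ha0
        _ ≤ a * Metric.infDist y G + ε := by nlinarith
    · rw [Metric.infDist_zero_of_mem (hGS (Or.inr h)), mul_zero]
  have h0 : Metric.infDist x G ≤ 0 := by nlinarith [Metric.infDist_nonneg (x := x) (s := G)]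
  intro y hy
  rw [hG.mem_iff_infDist_zero hG']
  exact le_antisymm ((hmax hy).trans h0) Metric.infDist_nonneg

theorem hausdorffEDist_image_le {S : X → X} {K : NNReal} (hS : LipschitzWith K S)
    {A B : Set X} (hA : IsCompact A) (hB : IsCompact B) (hA' : A.Nonempty) (hB' : B.Nonempty) :
    Metric.hausdorffEDist (S '' A) (S '' B) ≤ K * Metric.hausdorffEDist A B := by
  refine Metric.hausdorffEDist_le_of_infEDist ?_ ?_
  · rintro _ ⟨x, hx, rfl⟩
    obtain ⟨y, hy, hxy⟩ := hB.exists_infEDist_eq_edist hB' x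
    calc _ ≤ edist (S x) (S y) := Metric.infEDist_le_edist_of_mem (mem_image_of_mem S hy)
      _ ≤ K * edist x y := hS x y
      _ ≤ _ := by rw [← hxy]; gcongr; exact Metric.infEDist_le_hausdorffEDist_of_mem hx
  · rintro _ ⟨x, hx, rfl⟩
    obtain ⟨y, hy, hxy⟩ := hA.exists_infEDist_eq_edist hA' x
    calc _ ≤ edist (S x) (S y) := Metric.infEDist_le_edist_of_mem (mem_image_of_mem S hy)
      _ ≤ K * edist x y := hS x y
      _ ≤ _ := by
        rw [← hxy, Metric.hausdorffEDist_comm]; gcongr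
        exact Metric.infEDist_le_hausdorffEDist_of_mem hx

/-- Hutchinson's theorem for iterated function systems with condensation. -/
theorem existsUnique_isAttractor [CompleteSpace X] {N : ℕ} [NeZero N] [Nonempty X]
    {S : Fin N → X → X} {a : ℝ} (ha0 : 0 ≤ a) (ha : a < 1)
    (hS : ∀ i x y, dist (S i x) (S i y) ≤ a * dist x y) {C : Set X} (hC : IsCompact C) :
    ∃! F, IsAttractor S C F := by
  have hL : ∀ i, LipschitzWith ⟨a, ha0⟩ (S i) := fun i => LipschitzWith.of_dist_le_mul (hS i)
  let Φ : TopologicalSpace.NonemptyCompacts X → TopologicalSpace.NonemptyCompacts X := fun K =>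
    { carrier := (⋃ i, S i '' K) ∪ C
      isCompact' := (isCompact_iUnion fun i => K.isCompact.image (hL i).continuous).union hC
      nonempty' := by
        obtain ⟨x, hx⟩ := K.nonempty
        exact ⟨S 0 x, Or.inl (mem_iUnion.2 ⟨0, x, hx, rfl⟩)⟩ }
  have hΦ : ContractingWith ⟨a, ha0⟩ Φ := by
    refine ⟨by exact_mod_cast ha, fun K L => ?_⟩
    -- The condensation set is common to both images and contributes distance zero.
    refine Metric.hausdorffEDist_union_le.trans (max_le ?_ (by simp))
    refine Metric.hausdorffEDist_iUnion_le.trans (iSup_le fun i => ?_)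
    exact hausdorffEDist_image_le (hL i) K.isCompact L.isCompact K.nonempty L.nonempty
  have : Nonempty (TopologicalSpace.NonemptyCompacts X) := ⟨{Classical.arbitrary X}⟩
  have hfix := hΦ.fixedPoint_isFixedPt
  set K := ContractingWith.fixedPoint Φ hΦ
  refine ⟨K, ⟨K.nonempty, K.isCompact, (congrArg (fun L : TopologicalSpace.NonemptyCompacts X =>
    (L : Set X)) hfix).symm⟩, ?_⟩
  have hK : (K : Set X) = (⋃ i, S i '' K) ∪ C := (congrArg
    (fun L : TopologicalSpace.NonemptyCompacts X => (L : Set X)) hfix).symm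
  rintro G ⟨hG1, hG2, hG3⟩
  exact Subset.antisymm
    (subset_of_subset_hutchinson ha0 ha hS hG2 hG3.subset K.isCompact.isClosed K.nonempty
      hK.symm.subset)
    (subset_of_subset_hutchinson ha0 ha hS K.isCompact hK.subset hG2.isClosed hG1
      hG3.symm.subset)

end Attractor

/-! ### Covering numbers and upper bounds for the box dimension. -/

section BoxDim

variable {X : Type*} [MetricSpace X]

theorem boxCoveringNumber_le {δ : ℝ} {F : Set X} {𝒰 : Set (Set X)} (h : F ⊆ ⋃₀ 𝒰)
    (h' : ∀ U ∈ 𝒰, Metric.ediam U ≤ ENNReal.ofReal δ) : boxCoveringNumber δ F ≤ 𝒰.encard :=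
  (iInf_le _ 𝒰).trans ((iInf_le _ h).trans (iInf_le _ h'))

theorem exists_encard_eq_boxCoveringNumber (δ : ℝ) (F : Set X) :
    ∃ 𝒰 : Set (Set X), F ⊆ ⋃₀ 𝒰 ∧ (∀ U ∈ 𝒰, Metric.ediam U ≤ ENNReal.ofReal δ) ∧
      𝒰.encard = boxCoveringNumber δ F := by
  let P := {𝒰 : Set (Set X) // F ⊆ ⋃₀ 𝒰 ∧ ∀ U ∈ 𝒰, Metric.ediam U ≤ ENNReal.ofReal δ}
  have : Nonempty P := by
    refine ⟨⟨range fun x : X => {x}, fun x _ => ⟨{x}, ⟨x, rfl⟩, rfl⟩, ?_⟩⟩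
    rintro _ ⟨x, rfl⟩
    simp
  obtain ⟨⟨𝒰, h1, h2⟩, h3⟩ := ciInf_mem fun p : P => p.1.encard
  refine ⟨𝒰, h1, h2, le_antisymm ?_ (boxCoveringNumber_le h1 h2)⟩
  refine le_iInf fun 𝒱 => le_iInf fun h4 => le_iInf fun h5 => ?_
  exact h3.le.trans (iInf_le (fun p : P => p.1.encard) ⟨𝒱, h4, h5⟩)

theorem boxCoveringNumber_mono {δ : ℝ} {F G : Set X} (h : F ⊆ G) :
    boxCoveringNumber δ F ≤ boxCoveringNumber δ G := by
  obtain ⟨𝒰, h1, h2, h3⟩ := exists_encard_eq_boxCoveringNumber δ G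
  exact h3 ▸ boxCoveringNumber_le (h.trans h1) h2

theorem boxCoveringNumber_anti {δ δ' : ℝ} (F : Set X) (h : δ ≤ δ') :
    boxCoveringNumber δ' F ≤ boxCoveringNumber δ F := by
  obtain ⟨𝒰, h1, h2, h3⟩ := exists_encard_eq_boxCoveringNumber δ F
  exact h3 ▸ boxCoveringNumber_le h1 fun U hU => (h2 U hU).trans (ENNReal.ofReal_le_ofReal h)

theorem boxCoveringNumber_union_le (δ : ℝ) (F G : Set X) :
    boxCoveringNumber δ (F ∪ G) ≤ boxCoveringNumber δ F + boxCoveringNumber δ G := by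
  obtain ⟨𝒰, h1, h2, h3⟩ := exists_encard_eq_boxCoveringNumber δ F
  obtain ⟨𝒱, h4, h5, h6⟩ := exists_encard_eq_boxCoveringNumber δ G
  rw [← h3, ← h6]
  refine (boxCoveringNumber_le (𝒰 := 𝒰 ∪ 𝒱) ?_ ?_).trans (encard_union_le 𝒰 𝒱)
  · rw [sUnion_union]; exact union_subset_union h1 h4
  · rintro U (hU | hU)
    exacts [h2 U hU, h5 U hU]

theorem boxCoveringNumber_empty (δ : ℝ) : boxCoveringNumber δ (∅ : Set X) = 0 := by
  have := boxCoveringNumber_le (δ := δ) (F := (∅ : Set X)) (𝒰 := ∅) (by simp) (by simp)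
  simpa using this

theorem boxCoveringNumber_biUnion_le {ι : Type*} (δ : ℝ) (A : ι → Set X) (s : Finset ι) :
    boxCoveringNumber δ (⋃ i ∈ s, A i) ≤ ∑ i ∈ s, boxCoveringNumber δ (A i) := by
  classical
  induction s using Finset.induction_on with
  | empty => simp [boxCoveringNumber_empty]
  | insert i s hi ih =>
    rw [Finset.set_biUnion_insert, Finset.sum_insert hi]
    exact (boxCoveringNumber_union_le _ _ _).trans (by gcongr)

theorem boxCoveringNumber_iUnion_le {ι : Type*} [Fintype ι] (δ : ℝ) (A : ι → Set X) :
    boxCoveringNumber δ (⋃ i, A i) ≤ ∑ i, boxCoveringNumber δ (A i) := by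
  simpa using boxCoveringNumber_biUnion_le δ A Finset.univ

theorem boxCoveringNumber_image_le {S : X → X} {c : ℝ} (hc : 0 < c)
    (hS : ∀ x y, dist (S x) (S y) ≤ c * dist x y) (δ : ℝ) (F : Set X) :
    boxCoveringNumber δ (S '' F) ≤ boxCoveringNumber (δ / c) F := by
  obtain ⟨𝒰, h1, h2, h3⟩ := exists_encard_eq_boxCoveringNumber (δ / c) F
  have hL : LipschitzWith (NNReal.mk c hc.le) S := LipschitzWith.of_dist_le_mul hS
  rw [← h3]
  refine (boxCoveringNumber_le (𝒰 := (fun U => S '' U) '' 𝒰) ?_ ?_).trans (encard_image_le _ _)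
  · rintro _ ⟨x, hx, rfl⟩
    obtain ⟨U, hU, hxU⟩ := h1 hx
    exact ⟨S '' U, ⟨U, hU, rfl⟩, x, hxU, rfl⟩
  · rintro _ ⟨U, hU, rfl⟩
    refine (hL.ediam_image_le U).trans ((mul_le_mul_right (h2 U hU) _).trans ?_)
    have : ((NNReal.mk c hc.le : NNReal) : ℝ≥0∞) = ENNReal.ofReal c := by
      rw [ENNReal.ofReal, Real.toNNReal_of_nonneg hc.le]
    rw [this, ← ENNReal.ofReal_mul hc.le, mul_div_cancel₀ _ hc.ne']

theorem boxCoveringNumber_lt_top {δ : ℝ} (hδ : 0 < δ) {F : Set X} (hF : TotallyBounded F) :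
    boxCoveringNumber δ F < ⊤ := by
  obtain ⟨t, ht, htF⟩ := Metric.totallyBounded_iff.1 hF (δ / 2) (half_pos hδ)
  refine (boxCoveringNumber_le (𝒰 := (fun x => Metric.ball x (δ / 2)) '' t) ?_ ?_).trans_lt
    (ht.image _).encard_lt_top
  · rwa [sUnion_image]
  · rintro _ ⟨x, -, rfl⟩
    refine Metric.ediam_le fun y hy z hz => ?_
    rw [edist_dist]
    refine ENNReal.ofReal_le_ofReal ?_
    linarith [dist_triangle_right y z x, Metric.mem_ball.1 hy, Metric.mem_ball.1 hz]

theorem upperBoxDim_mono {F G : Set X} (h : F ⊆ G) : upperBoxDim F ≤ upperBoxDim G := by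
  refine limsup_le_limsup ?_
  filter_upwards [Ioo_mem_nhdsGT zero_lt_one] with δ hδ
  refine EReal.div_le_div_right_of_nonneg ?_ (ENNReal.log_le_log ?_)
  · exact_mod_cast (neg_pos.2 (Real.log_neg hδ.1 hδ.2)).le
  · exact_mod_cast boxCoveringNumber_mono h

theorem log_div_neg_log_le_iff {δ v : ℝ} (h0 : 0 < δ) (h1 : δ < 1) {A : ℝ≥0∞} :
    ENNReal.log A / ((-Real.log δ : ℝ) : EReal) ≤ v ↔ A ≤ ENNReal.ofReal (δ ^ (-v)) := by
  have hp : 0 < -Real.log δ := neg_pos.2 (Real.log_neg h0 h1)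
  rw [EReal.div_le_iff_le_mul (by exact_mod_cast hp) (EReal.coe_ne_top _), ← EReal.coe_mul,
    ← ENNReal.log_le_log_iff (y := ENNReal.ofReal _),
    ENNReal.log_ofReal_of_pos (Real.rpow_pos_of_pos h0 _), Real.log_rpow h0]
  rw [show -Real.log δ * v = -v * Real.log δ by ring]

/-- The constant is harmless: for any `v > u`, `K * δ ^ (v - u)` tends to `0`, so the bound is
eventually below `δ ^ (-v)`. -/
theorem upperBoxDim_le_of_forall_le {F : Set X} {K u δ₀ : ℝ} (hδ₀ : 0 < δ₀)
    (h : ∀ δ, 0 < δ → δ < δ₀ → (boxCoveringNumber δ F : ℝ≥0∞) ≤ ENNReal.ofReal (K * δ ^ (-u))) :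
    upperBoxDim F ≤ u := by
  refine EReal.le_of_forall_lt_iff_le.1 fun v hv => ?_
  have huv : 0 < v - u := sub_pos.2 (by exact_mod_cast hv)
  refine limsup_le_of_le (by isBoundedDefault) ?_
  have h1 : Tendsto (fun δ : ℝ => K * δ ^ (v - u)) (𝓝[>] 0) (𝓝 (K * 0)) := by
    refine (Tendsto.const_mul K ?_).mono_left nhdsWithin_le_nhds
    have := (Real.continuousAt_rpow_const 0 (v - u) (Or.inr huv.le)).tendsto
    rwa [Real.zero_rpow huv.ne'] at this
  rw [mul_zero] at h1
  filter_upwards [Ioo_mem_nhdsGT zero_lt_one, Ioo_mem_nhdsGT hδ₀,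
    h1.eventually (gt_mem_nhds zero_lt_one)] with δ hδ hδ' hK
  rw [log_div_neg_log_le_iff hδ.1 hδ.2]
  refine (h δ hδ.1 hδ'.2).trans (ENNReal.ofReal_le_ofReal ?_)
  have : δ ^ (-u) = δ ^ (v - u) * δ ^ (-v) := by rw [← Real.rpow_add hδ.1]; congr 1; ring
  rw [this, ← mul_assoc]
  exact mul_le_of_le_one_left (Real.rpow_nonneg hδ.1.le _) hK.le

theorem exists_boxCoveringNumber_le {F : Set X} (hF : TotallyBounded F) {u : ℝ} (hu0 : 0 ≤ u)
    (hu : upperBoxDim F < u) : ∃ K : ℝ, 0 ≤ K ∧ ∀ δ, 0 < δ → δ < 1 →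
      (boxCoveringNumber δ F : ℝ≥0∞) ≤ ENNReal.ofReal (K * δ ^ (-u)) := by
  have h := eventually_lt_of_limsup_lt hu
  rw [eventually_iff, mem_nhdsGT_iff_exists_Ioo_subset] at h
  obtain ⟨δ₀, hδ₀, hsub⟩ := h
  have hfin := boxCoveringNumber_lt_top hδ₀ hF
  obtain ⟨A, hA⟩ := ENat.ne_top_iff_exists.1 hfin.ne
  refine ⟨max 1 A, by positivity, fun δ h0 h1 => ?_⟩
  have hp := Real.rpow_nonneg h0.le (-u)
  rcases lt_or_ge δ δ₀ with hlt | hge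
  · have := (log_div_neg_log_le_iff h0 h1).1 (hsub ⟨h0, hlt⟩).le
    exact this.trans (ENNReal.ofReal_le_ofReal (le_mul_of_one_le_left hp (le_max_left _ _)))
  -- At scales above `δ₀` the count is at most `A`, its value at `δ₀`, while `δ ^ (-u) ≥ 1`.
  · have h2 : (boxCoveringNumber δ F : ℝ≥0∞) ≤ ((A : ℕ∞) : ℝ≥0∞) := by
      rw [hA]; exact_mod_cast boxCoveringNumber_anti F hge
    refine h2.trans ?_
    rw [ENat.toENNReal_coe, ← ENNReal.ofReal_natCast]
    refine ENNReal.ofReal_le_ofReal ((le_max_right 1 _).trans ?_)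
    exact le_mul_of_one_le_right (by positivity)
      (Real.one_le_rpow_of_pos_of_le_one_of_nonpos h0 h1.le (by linarith))

/-- If `F ⊆ S 1 (F) ∪ ⋯ ∪ S N (F) ∪ C` with maps `S i` contracting by `c i` and `∑ c i ^ u < 1`,
then the upper box dimension of `F` is at most `u` as soon as that of `C` is less than `u`. -/
theorem upperBoxDim_le_of_subset_iUnion {ι : Type*} [Fintype ι] {S : ι → X → X} {c : ι → ℝ}
    (hc0 : ∀ i, 0 < c i) (hc1 : ∀ i, c i < 1)
    (hS : ∀ i x y, dist (S i x) (S i y) ≤ c i * dist x y) {C F : Set X}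
    (hF : TotallyBounded F) (hC : TotallyBounded C) (hFS : F ⊆ (⋃ i, S i '' F) ∪ C)
    {u : ℝ} (hu0 : 0 ≤ u) (hu : ∑ i, c i ^ u < 1) (hCu : upperBoxDim C < u) :
    upperBoxDim F ≤ u := by
  obtain ⟨K₁, hK₁, hC'⟩ := exists_boxCoveringNumber_le hC hu0 hCu
  obtain ⟨A, hA⟩ := ENat.ne_top_iff_exists.1 (boxCoveringNumber_lt_top zero_lt_one hF).ne
  obtain ⟨a, ha0, ha1, ha⟩ : ∃ a : ℝ, 0 < a ∧ a < 1 ∧ ∀ i, c i ≤ a := by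
    rcases isEmpty_or_nonempty ι with h | h
    · exact ⟨1 / 2, by norm_num, by norm_num, fun i => isEmptyElim i⟩
    · obtain ⟨i, hi⟩ := Finite.exists_max c
      exact ⟨c i, hc0 i, hc1 i, hi⟩
  obtain ⟨b, hb0, hb1, hb⟩ : ∃ b : ℝ, 0 < b ∧ b ≤ 1 ∧ ∀ i, b ≤ c i := by
    rcases isEmpty_or_nonempty ι with h | h
    · exact ⟨1 / 2, by norm_num, by norm_num, fun i => isEmptyElim i⟩
    · obtain ⟨i, hi⟩ := Finite.exists_min c
      exact ⟨c i, hc0 i, (hc1 i).le, hi⟩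
  set q := ∑ i, c i ^ u
  have hq : 0 < 1 - q := sub_pos.2 hu
  -- The first entry handles scales in `[1, 1 / b]`, where the count is at most `A`; the second
  -- gives `q * K + K₁ ≤ K`, which closes the induction.
  set K := max (A * b ^ (-u)) (K₁ / (1 - q))
  have hK0 : 0 ≤ K := le_max_of_le_left (mul_nonneg (Nat.cast_nonneg _) (Real.rpow_nonneg hb0.le _))
  have hKK : q * K + K₁ ≤ K := by
    have := (div_le_iff₀ hq).1 (le_max_right (A * b ^ (-u)) (K₁ / (1 - q)))
    change K₁ ≤ K * (1 - q) at this
    linarith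
  -- The range extends to `1 / b` because `δ / c i` can exceed `1` when `δ < 1`. Dividing by `c i ≤
  -- a` gains one power of `a`.
  have main : ∀ n : ℕ, ∀ δ, a ^ n ≤ δ → δ ≤ 1 / b →
      (boxCoveringNumber δ F : ℝ≥0∞) ≤ ENNReal.ofReal (K * δ ^ (-u)) := by
    have base : ∀ δ : ℝ, 1 ≤ δ → δ ≤ 1 / b →
        (boxCoveringNumber δ F : ℝ≥0∞) ≤ ENNReal.ofReal (K * δ ^ (-u)) := by
      intro δ h1 h2
      have h3 : (boxCoveringNumber δ F : ℝ≥0∞) ≤ ((A : ℕ∞) : ℝ≥0∞) := by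
        rw [hA]; exact_mod_cast boxCoveringNumber_anti F h1
      refine h3.trans ?_
      rw [ENat.toENNReal_coe, ← ENNReal.ofReal_natCast]
      refine ENNReal.ofReal_le_ofReal ?_
      have hδ0 : 0 < δ := by linarith
      have h4 : (1 / b) ^ (-u) ≤ δ ^ (-u) :=
        Real.rpow_le_rpow_of_nonpos hδ0 h2 (by linarith)
      calc (A : ℝ) = A * b ^ (-u) * (1 / b) ^ (-u) := by
            rw [mul_assoc, ← Real.mul_rpow hb0.le (by positivity), mul_one_div_cancel hb0.ne',
              Real.one_rpow, mul_one]
        _ ≤ K * δ ^ (-u) := mul_le_mul (le_max_left _ _) h4 (by positivity) hK0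
    intro n
    induction n with
    | zero => simpa using base
    | succ n ih =>
      intro δ h1 h2
      rcases le_or_gt 1 δ with h | h
      · exact base δ h h2
      have hδ0 : 0 < δ := lt_of_lt_of_le (by positivity) h1
      have step : boxCoveringNumber δ F ≤
          ∑ i, boxCoveringNumber (δ / c i) F + boxCoveringNumber δ C :=
        (boxCoveringNumber_mono hFS).trans ((boxCoveringNumber_union_le _ _ _).trans
          (add_le_add_left ((boxCoveringNumber_iUnion_le _ _).trans
            (Finset.sum_le_sum fun i _ => boxCoveringNumber_image_le (hc0 i) (hS i) _ _)) _))
      have step' : (boxCoveringNumber δ F : ℝ≥0∞) ≤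
          ∑ i, (boxCoveringNumber (δ / c i) F : ℝ≥0∞) + boxCoveringNumber δ C := by
        have := ENat.toENNReal_le.2 step
        rwa [ENat.toENNReal_add, show ((∑ i, boxCoveringNumber (δ / c i) F : ℕ∞) : ℝ≥0∞) =
          ∑ i, (boxCoveringNumber (δ / c i) F : ℝ≥0∞) from
            map_sum ENat.toENNRealRingHom _ _] at this
      refine step'.trans ?_
      have h3 : ∀ i, (boxCoveringNumber (δ / c i) F : ℝ≥0∞) ≤
          ENNReal.ofReal (K * (δ / c i) ^ (-u)) := fun i => by
        refine ih _ ?_ ?_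
        · rw [le_div_iff₀ (hc0 i)]
          refine le_trans ?_ h1
          rw [pow_succ]
          exact mul_le_mul_of_nonneg_left (ha i) (by positivity)
        · exact div_le_div₀ zero_le_one h.le hb0 (hb i)
      refine (add_le_add (Finset.sum_le_sum fun i _ => h3 i) (hC' δ hδ0 h)).trans ?_
      have hp := Real.rpow_nonneg hδ0.le (-u)
      rw [← ENNReal.ofReal_sum_of_nonneg (fun i _ => mul_nonneg hK0
        (Real.rpow_nonneg (div_pos hδ0 (hc0 i)).le _)), ← ENNReal.ofReal_add
        (Finset.sum_nonneg fun i _ => mul_nonneg hK0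
        (Real.rpow_nonneg (div_pos hδ0 (hc0 i)).le _)) (mul_nonneg hK₁ hp)]
      refine ENNReal.ofReal_le_ofReal ?_
      have h5 : ∑ i, K * (δ / c i) ^ (-u) = q * K * δ ^ (-u) := by
        simp only [q, Finset.sum_mul]
        refine Finset.sum_congr rfl fun i _ => ?_
        rw [Real.div_rpow hδ0.le (hc0 i).le, Real.rpow_neg (hc0 i).le, div_inv_eq_mul]
        ring
      rw [h5, ← add_mul]
      exact mul_le_mul_of_nonneg_right hKK hp
  refine upperBoxDim_le_of_forall_le (K := K) zero_lt_one fun δ h0 h1 => ?_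
  obtain ⟨n, hn⟩ := exists_pow_lt_of_lt_one h0 ha1
  exact main n δ hn.le (h1.le.trans (one_le_one_div hb0 hb1))

end BoxDim

/-- The upper box dimension of a bounded subset of `ℝ^d` is at most `d`. -/
theorem upperBoxDim_le_of_isBounded {d : ℕ} {F : Set (EuclideanSpace ℝ (Fin d))}
    (hF : Bornology.IsBounded F) : upperBoxDim F ≤ (d : ℝ) := by
  obtain ⟨R, hR⟩ := hF.exists_norm_le
  set Q : Set (EuclideanSpace ℝ (Fin d)) := {x | ∀ i, |x i| ≤ R}
  have hFQ : F ⊆ Q := fun x hx i => (PiLp.norm_apply_le x i).trans (hR x hx)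
  have hQ : TotallyBounded Q := by
    have : Bornology.IsBounded Q := by
      refine isBounded_iff_forall_norm_le.2 ⟨√(∑ _ : Fin d, R ^ 2), fun x hx => ?_⟩
      rw [EuclideanSpace.norm_eq]
      exact Real.sqrt_le_sqrt (Finset.sum_le_sum fun i _ =>
        pow_le_pow_left₀ (norm_nonneg _) (hx i) 2)
    exact this.isCompact_closure.totallyBounded.subset subset_closure
  refine (upperBoxDim_mono hFQ).trans (EReal.le_of_forall_lt_iff_le.1 fun u hu => ?_)
  have hu : (d : ℝ) < u := by exact_mod_cast hu
  -- The cube `Q` is covered by its `2 ^ d` half-size copies, one per sign pattern, and `2 ^ d * (1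
  -- / 2) ^ u < 1` for `u > d`.
  let S : (Fin d → Bool) → EuclideanSpace ℝ (Fin d) → EuclideanSpace ℝ (Fin d) := fun e x =>
    (1 / 2 : ℝ) • (x + WithLp.toLp 2 fun i => if e i then R else -R)
  refine upperBoxDim_le_of_subset_iUnion (S := S) (c := fun _ => 1 / 2) (C := ∅) (by norm_num)
    (by norm_num) ?_ hQ totallyBounded_empty ?_ ((Nat.cast_nonneg d).trans hu.le) ?_ ?_
  · intro e x y
    simp [S, dist_smul₀]
  · intro x hx
    refine Or.inl (mem_iUnion.2 ⟨fun i => decide (0 ≤ x i),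
      (2 : ℝ) • x - WithLp.toLp 2 fun i => if 0 ≤ x i then R else -R, fun i => ?_, ?_⟩)
    · have := abs_le.1 (hx i)
      by_cases h : 0 ≤ x i <;> simp only [PiLp.sub_apply, PiLp.smul_apply, smul_eq_mul, h, abs_le,
        if_true, if_false] <;> constructor <;> linarith
    · ext i
      by_cases h : 0 ≤ x i <;> simp [S, h] <;> ring
  · simp only [Finset.sum_const, Finset.card_univ, Fintype.card_fun, Fintype.card_bool,
      Fintype.card_fin, nsmul_eq_mul]
    push_cast
    rw [← Real.rpow_natCast, one_div, Real.inv_rpow (by norm_num), ← div_eq_mul_inv,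
      ← Real.rpow_sub (by norm_num)]
    exact Real.rpow_lt_one_of_one_lt_of_neg (by norm_num) (by linarith)
  · refine lt_of_le_of_lt (b := ⊥) ?_ (EReal.bot_lt_coe u)
    refine limsup_le_of_le (by isBoundedDefault) ?_
    filter_upwards [Ioo_mem_nhdsGT zero_lt_one] with δ hδ
    rw [boxCoveringNumber_empty, ENat.toENNReal_zero, ENNReal.log_zero,
      EReal.bot_div_of_pos_ne_top (by exact_mod_cast neg_pos.2 (Real.log_neg hδ.1 hδ.2))
        (EReal.coe_ne_top _)]

/-! ### Word points and transversality. -/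

section Words

variable {E : Type*} [NormedAddCommGroup E] [NormedSpace ℝ E] {N : ℕ}

theorem sum_words_succ {N n : ℕ} {M : Type*} [AddCommMonoid M] (f : (Fin (n + 1) → Fin N) → M) :
    ∑ w, f w = ∑ i, ∑ w : Fin n → Fin N, f (Fin.cons i w) := by
  rw [← Fintype.sum_prod_type']
  exact (Fintype.sum_equiv (Fin.consEquiv fun _ => Fin N) _ _ fun _ => rfl).symm

/-- The image of the origin under `x ↦ T (w 0) x + t (w 0)`, …, `x ↦ T (w (n-1)) x + t (w (n-1))`
(the last one applied first), as a linear function of the translation vector `t`. -/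
noncomputable def wordPoint (T : Fin N → E →ₗ[ℝ] E) :
    (n : ℕ) → (Fin n → Fin N) → (Fin N → E) →ₗ[ℝ] E
  | 0, _ => 0
  | n + 1, w => LinearMap.proj (w 0) + T (w 0) ∘ₗ wordPoint T n (Fin.tail w)

theorem wordPoint_succ (T : Fin N → E →ₗ[ℝ] E) {n : ℕ} (w : Fin (n + 1) → Fin N)
    (t : Fin N → E) : wordPoint T (n + 1) w t = t (w 0) + T (w 0) (wordPoint T n (Fin.tail w) t) :=
  rfl

/-- The sum of `a ^ k` over the positions `k` at which the word `w` has the letter `i`. -/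
noncomputable def letterWeight (a : ℝ) : (n : ℕ) → (Fin n → Fin N) → Fin N → ℝ
  | 0, _, _ => 0
  | n + 1, w, i => (if w 0 = i then 1 else 0) + a * letterWeight a n (Fin.tail w) i

theorem norm_wordPoint_single_le {T : Fin N → E →ₗ[ℝ] E} {a : ℝ} (ha0 : 0 ≤ a)
    (hT : ∀ i x, ‖T i x‖ ≤ a * ‖x‖) (i : Fin N) (h : E) {n : ℕ} (w : Fin n → Fin N) :
    ‖wordPoint T n w (Pi.single i h)‖ ≤ letterWeight a n w i * ‖h‖ := by
  induction n with
  | zero => simp [wordPoint, letterWeight]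
  | succ n ih =>
    rw [wordPoint_succ, letterWeight, add_mul]
    refine (norm_add_le _ _).trans (add_le_add ?_ ?_)
    · by_cases hi : w 0 = i
      · simp [hi]
      · simp [hi]
    · rw [mul_assoc]
      exact (hT _ _).trans (mul_le_mul_of_nonneg_left (ih _) ha0)

/-- A position carries at most one of two distinct letters, so the two weights together are
dominated by a single geometric series. -/
theorem letterWeight_add_le {a : ℝ} (ha0 : 0 ≤ a) (ha1 : a < 1) {i j : Fin N} (hij : i ≠ j)
    {n : ℕ} (w : Fin n → Fin N) : letterWeight a n w i + letterWeight a n w j ≤ 1 / (1 - a) := by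
  have h1 : 0 < 1 - a := by linarith
  induction n with
  | zero => simp [letterWeight, h1.le]
  | succ n ih =>
    have h2 := mul_le_mul_of_nonneg_left (ih (Fin.tail w)) ha0
    have h3 : 1 + a * (1 / (1 - a)) = 1 / (1 - a) := by field_simp; ring
    have h4 : (if w 0 = i then (1 : ℝ) else 0) + (if w 0 = j then (1 : ℝ) else 0) ≤ 1 := by
      by_cases hi : w 0 = i
      · have : w 0 ≠ j := fun h => hij (hi.symm.trans h)
        simp [hi, hij]
      · simp only [hi, if_false, zero_add]
        split_ifs <;> norm_num
    simp only [letterWeight]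
    linarith

/-- Solomyak's transversality: if two words start with different letters, then the difference of
their points depends on one of the two corresponding translation vectors non-degenerately. -/
theorem exists_norm_le_wordPoint_single {T : Fin N → E →ₗ[ℝ] E} {a : ℝ} (ha0 : 0 ≤ a)
    (ha1 : a < 1) (hT : ∀ i x, ‖T i x‖ ≤ a * ‖x‖) {n : ℕ} {w v : Fin (n + 1) → Fin N}
    (hwv : w 0 ≠ v 0) : ∃ i, ∀ h, (1 - a / (1 - a)) * ‖h‖ ≤
      ‖(wordPoint T (n + 1) w - wordPoint T (n + 1) v) (Pi.single i h)‖ := by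
  have key : ∀ {w v : Fin (n + 1) → Fin N}, w 0 ≠ v 0 → ∀ h,
      (1 - a * (letterWeight a n (Fin.tail w) (w 0) + letterWeight a n (Fin.tail v) (w 0))) * ‖h‖ ≤
        ‖(wordPoint T (n + 1) w - wordPoint T (n + 1) v) (Pi.single (w 0) h)‖ := by
    intro w v hwv h
    rw [LinearMap.sub_apply, wordPoint_succ, wordPoint_succ, Pi.single_eq_same,
      Pi.single_eq_of_ne hwv.symm, zero_add]
    have h1 := (hT (w 0) _).trans (mul_le_mul_of_nonneg_left
      (norm_wordPoint_single_le ha0 hT (w 0) h (Fin.tail w)) ha0)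
    have h2 := (hT (v 0) _).trans (mul_le_mul_of_nonneg_left
      (norm_wordPoint_single_le ha0 hT (w 0) h (Fin.tail v)) ha0)
    set A := T (w 0) (wordPoint T n (Fin.tail w) (Pi.single (w 0) h))
    set B := T (v 0) (wordPoint T n (Fin.tail v) (Pi.single (w 0) h))
    have h3 : ‖h‖ ≤ ‖h + A - B‖ + ‖A‖ + ‖B‖ := by
      calc ‖h‖ = ‖(h + A - B) - A + B‖ := by congr 1; abel
        _ ≤ _ := (norm_add_le _ _).trans (by gcongr; exact norm_sub_le _ _)
    nlinarith
  -- The weights of the letters `w 0` and `v 0` over both tails total at most `2 / (1 - a)`, so one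
  -- of these letters has combined weight at most `1 / (1 - a)`; perturbing its translation vector
  -- works.
  have hw := letterWeight_add_le ha0 ha1 hwv (Fin.tail w)
  have hv := letterWeight_add_le ha0 ha1 hwv (Fin.tail v)
  have e : a / (1 - a) = a * (1 / (1 - a)) := by ring
  by_cases hle : letterWeight a n (Fin.tail w) (w 0) + letterWeight a n (Fin.tail v) (w 0) ≤
      1 / (1 - a)
  · refine ⟨w 0, fun h => le_trans (mul_le_mul_of_nonneg_right ?_ (norm_nonneg h)) (key hwv h)⟩
    rw [e]
    linarith [mul_le_mul_of_nonneg_left hle ha0]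
  · refine ⟨v 0, fun h => le_trans (mul_le_mul_of_nonneg_right ?_ (norm_nonneg h))
      ((key hwv.symm h).trans_eq ?_)⟩
    · have : letterWeight a n (Fin.tail v) (v 0) + letterWeight a n (Fin.tail w) (v 0) ≤
        1 / (1 - a) := by linarith
      rw [e]
      linarith [mul_le_mul_of_nonneg_left this ha0]
    · rw [← norm_neg, ← LinearMap.neg_apply, neg_sub]

/-- The composition of maps along `w` sends `0` to the word point and `y` into `F`, and contracts
their distance by at least `a ^ n`. -/
theorem exists_norm_sub_wordPoint_le {T : Fin N → E →ₗ[ℝ] E} {a : ℝ} (ha0 : 0 ≤ a)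
    (hT : ∀ i x, ‖T i x‖ ≤ a * ‖x‖) {t : Fin N → E} {F : Set E}
    (hF : ∀ i, ∀ x ∈ F, T i x + t i ∈ F) {y : E} (hy : y ∈ F) {n : ℕ} (w : Fin n → Fin N) :
    ∃ z ∈ F, ‖z - wordPoint T n w t‖ ≤ a ^ n * ‖y‖ := by
  induction n with
  | zero => exact ⟨y, hy, by simp [wordPoint]⟩
  | succ n ih =>
    obtain ⟨z, hz, hzy⟩ := ih (Fin.tail w)
    refine ⟨_, hF (w 0) z hz, ?_⟩
    rw [wordPoint_succ, add_comm (t (w 0)), add_sub_add_right_eq_sub, ← map_sub, pow_succ',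
      mul_assoc]
    exact (hT _ _).trans (mul_le_mul_of_nonneg_left hzy ha0)

end Words

/-! ### Measure of the parameters with small image. -/

section Slab

variable {E : Type*} [NormedAddCommGroup E] [NormedSpace ℝ E] [FiniteDimensional ℝ E]
  [MeasureSpace E] [BorelSpace E] [(volume : Measure E).IsAddHaarMeasure]

/-- A slab `{‖y t‖ ≤ r}` of a linear map that is non-degenerate in one coordinate has measure
`O(r ^ dim E)` within a ball. -/
theorem exists_volume_slab_le (N : ℕ) (R : ℝ) {ε : ℝ} (hε : 0 < ε) :
    ∃ C : ℝ, 0 ≤ C ∧ ∀ (y : (Fin N → E) →ₗ[ℝ] E) (i : Fin N),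
      (∀ h, ε * ‖h‖ ≤ ‖y (Pi.single i h)‖) → ∀ r : ℝ, 0 ≤ r →
        (volume.restrict (Metric.closedBall (0 : Fin N → E) R)).real {t | ‖y t‖ ≤ r} ≤
          C * r ^ Module.finrank ℝ E := by
  cases N with
  | zero => exact ⟨0, le_rfl, fun _ i => i.elim0⟩
  | succ k =>
  set d := Module.finrank ℝ E
  set V := (volume : Measure E).real (Metric.closedBall 0 1)
  set W := (volume : Measure (Fin k → E)).real (Metric.closedBall 0 R)
  refine ⟨(2 / ε) ^ d * V * W, by positivity, fun y i hy r hr => ?_⟩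
  have hyc : Continuous y := y.continuous_of_finiteDimensional
  have hAm : MeasurableSet {t | ‖y t‖ ≤ r} := (isClosed_le hyc.norm continuous_const).measurableSet
  set A := {t | ‖y t‖ ≤ r} ∩ Metric.closedBall (0 : Fin (k + 1) → E) R
  have hA : MeasurableSet A := hAm.inter Metric.isClosed_closedBall.measurableSet
  have hmp := (volume_preserving_piFinSuccAbove (fun _ : Fin (k + 1) => E) i).symm
  -- Fubini with coordinate `i` singled out: two points `h`, `h₀` of a slice satisfy `ε * ‖h - h₀‖ ≤
  -- 2 * r`, so the slice lies in a ball of radius `2 * r / ε`.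
  have hslice : ∀ t' : Fin k → E,
      volume ((fun h => (h, t')) ⁻¹' ((MeasurableEquiv.piFinSuccAbove (fun _ => E) i).symm ⁻¹' A)) ≤
        (Metric.closedBall (0 : Fin k → E) R).indicator
          (fun _ => ENNReal.ofReal ((2 * r / ε) ^ d) * volume (Metric.closedBall (0 : E) 1)) t' := by
    intro t'
    have hmem : ∀ h, h ∈ (fun h => (h, t')) ⁻¹'
        ((MeasurableEquiv.piFinSuccAbove (fun _ => E) i).symm ⁻¹' A) →
        ‖y (i.insertNth h t')‖ ≤ r ∧ ‖t'‖ ≤ R := by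
      rintro h ⟨h1, h2⟩
      refine ⟨h1, ?_⟩
      have h3 : ‖(i.insertNth h t' : Fin (k + 1) → E)‖ ≤ R := mem_closedBall_zero_iff.1 h2
      refine (pi_norm_le_iff_of_nonneg ((norm_nonneg _).trans h3)).2 fun j => ?_
      have := (norm_le_pi_norm (i.insertNth h t' : Fin (k + 1) → E) (i.succAbove j)).trans h3
      simpa using this
    by_cases ht' : t' ∈ Metric.closedBall (0 : Fin k → E) R
    · rw [indicator_of_mem ht']
      rcases ((fun h => (h, t')) ⁻¹' ((MeasurableEquiv.piFinSuccAbove (fun _ => E) i).symm ⁻¹' A)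
        ).eq_empty_or_nonempty with he | ⟨h₀, hh₀⟩
      · rw [he]; simp
      · have hr' : 0 ≤ 2 * r / ε := by positivity
        rw [← Measure.addHaar_closedBall' volume h₀ hr']
        refine measure_mono fun h hh => ?_
        rw [mem_closedBall_iff_norm, le_div_iff₀ hε, mul_comm]
        refine (hy (h - h₀)).trans ?_
        rw [← Fin.insertNth_sub_same (α := fun _ => E) i h h₀ t', map_sub]
        exact (norm_sub_le _ _).trans (by linarith [(hmem h hh).1, (hmem h₀ hh₀).1])
    · rw [indicator_of_notMem ht']
      refine (measure_mono_null (t := ∅) (fun h hh => ht' ?_) measure_empty).le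
      exact mem_closedBall_zero_iff.2 (hmem h hh).2
  have hvol : volume A ≤ ENNReal.ofReal ((2 * r / ε) ^ d) * volume (Metric.closedBall (0 : E) 1) *
      volume (Metric.closedBall (0 : Fin k → E) R) := by
    rw [← hmp.measure_preimage hA.nullMeasurableSet, Measure.volume_eq_prod,
      Measure.prod_apply_symm (hmp.measurable hA)]
    refine (lintegral_mono hslice).trans ?_
    rw [lintegral_indicator Metric.isClosed_closedBall.measurableSet, setLIntegral_const]
  have hfin : ENNReal.ofReal ((2 * r / ε) ^ d) * volume (Metric.closedBall (0 : E) 1) *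
      volume (Metric.closedBall (0 : Fin k → E) R) ≠ ⊤ :=
    ENNReal.mul_ne_top (ENNReal.mul_ne_top ENNReal.ofReal_ne_top
      (isCompact_closedBall _ _).measure_lt_top.ne) (isCompact_closedBall _ _).measure_lt_top.ne
  rw [measureReal_restrict_apply hAm, measureReal_def]
  refine (ENNReal.toReal_mono hfin hvol).trans_eq ?_
  rw [ENNReal.toReal_mul, ENNReal.toReal_mul, ENNReal.toReal_ofReal (by positivity)]
  simp only [V, W, measureReal_def]
  rw [mul_div_right_comm, mul_pow]
  ring

end Slab

/-- If the points of a probability vector `P` are sorted into the members of a finite family, then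
the family has at least as many members as the inverse of the collision probability. -/
theorem one_le_ncard_mul_sum {α β : Type*} [Fintype α] {𝒰 : Set β} (h𝒰 : 𝒰.Finite) {f : α → β}
    (hf : ∀ w, f w ∈ 𝒰) {P : α → ℝ} (hP1 : ∑ w, P w = 1) {Q : α → α → ℝ} (hQ : ∀ w v, 0 ≤ Q w v)
    (hPQ : ∀ w v, f w = f v → P w * P v ≤ Q w v) :
    1 ≤ (𝒰.ncard : ℝ) * ∑ w, ∑ v, Q w v := by
  classical
  have hmaps : ∀ w ∈ (Finset.univ : Finset α), f w ∈ h𝒰.toFinset := fun w _ => by simpa using hf w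
  have h1 : ∑ U ∈ h𝒰.toFinset, ∑ w with f w = U, P w = 1 :=
    (Finset.sum_fiberwise_of_maps_to hmaps P).trans hP1
  -- Cauchy–Schwarz for the masses of the fibres of `f`; the sum of their squares is the weight of
  -- the pairs sharing a fibre.
  have h2 := sq_sum_le_card_mul_sum_sq (s := h𝒰.toFinset) (f := fun U => ∑ w with f w = U, P w)
  rw [h1, one_pow, ← ncard_eq_toFinset_card 𝒰 h𝒰] at h2
  refine h2.trans (mul_le_mul_of_nonneg_left ?_ (Nat.cast_nonneg _))
  rw [← Finset.sum_fiberwise_of_maps_to hmaps]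
  refine Finset.sum_le_sum fun U _ => ?_
  rw [sq, Finset.sum_mul_sum]
  refine Finset.sum_le_sum fun w hw => ?_
  refine (Finset.sum_le_sum fun v hv => hPQ w v ?_).trans
    (Finset.sum_le_sum_of_subset_of_nonneg (Finset.subset_univ _) fun v _ _ => hQ w v)
  rw [(Finset.mem_filter.1 hw).2, (Finset.mem_filter.1 hv).2]

/-! ### Mean collision probability of word points. -/

section Energy

variable {E : Type*} [NormedAddCommGroup E] [NormedSpace ℝ E] {N : ℕ}

theorem sum_prod_words {p : Fin N → ℝ} (hp : ∑ i, p i = 1) (n : ℕ) :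
    ∑ w : Fin n → Fin N, ∏ k, p (w k) = 1 := by
  simpa [hp] using (Finset.prod_univ_sum (fun _ : Fin n => Finset.univ) fun _ => p).symm

variable [MeasurableSpace (Fin N → E)]

/-- The energy `∑ p_w p_v ν{t : |x_w(t) - x_v(t)| ≤ r}` over the pairs of words of length `n`. -/
noncomputable def wordEnergy (T : Fin N → E →ₗ[ℝ] E) (p : Fin N → ℝ) (ν : Measure (Fin N → E))
    (n : ℕ) (r : ℝ) : ℝ :=
  ∑ w : Fin n → Fin N, ∑ v : Fin n → Fin N, (∏ k, p (w k)) * (∏ k, p (v k)) *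
    ν.real {t | ‖wordPoint T n w t - wordPoint T n v t‖ ≤ r}

/-- Pairs with different first letters cost at most `D`, their total weight being at most `1`. For a
common first letter `i` the translation cancels and the similarity `T i` rescales the condition to
the tails at radius `r / c i`. -/
theorem wordEnergy_succ_le {T : Fin N → E →ₗ[ℝ] E} {c : Fin N → ℝ} (hc : ∀ i, 0 < c i)
    (hT : ∀ i x, ‖T i x‖ = c i * ‖x‖) {p : Fin N → ℝ} (hp0 : ∀ i, 0 ≤ p i) (hp : ∑ i, p i = 1)
    {ν : Measure (Fin N → E)} {n : ℕ} {r D : ℝ} (hD0 : 0 ≤ D)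
    (hD : ∀ w v : Fin (n + 1) → Fin N, w 0 ≠ v 0 →
      ν.real {t | ‖wordPoint T (n + 1) w t - wordPoint T (n + 1) v t‖ ≤ r} ≤ D) :
    wordEnergy T p ν (n + 1) r ≤ D + ∑ i, p i ^ 2 * wordEnergy T p ν n (r / c i) := by
  have hP : ∀ w : Fin n → Fin N, 0 ≤ ∏ k, p (w k) := fun w => Finset.prod_nonneg fun k _ => hp0 _
  have hterm : ∀ (i : Fin N) (w : Fin n → Fin N) (j : Fin N) (v : Fin n → Fin N),
      (∏ k, p ((Fin.cons i w : Fin (n + 1) → Fin N) k)) *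
        (∏ k, p ((Fin.cons j v : Fin (n + 1) → Fin N) k)) *
        ν.real {t | ‖wordPoint T (n + 1) (Fin.cons i w) t -
          wordPoint T (n + 1) (Fin.cons j v) t‖ ≤ r} ≤
      p i * (∏ k, p (w k)) * (p j * ∏ k, p (v k)) * D + if i = j then
        p i ^ 2 * ((∏ k, p (w k)) * (∏ k, p (v k)) *
          ν.real {t | ‖wordPoint T n w t - wordPoint T n v t‖ ≤ r / c i}) else 0 := by
    intro i w j v
    simp only [Fin.prod_univ_succ, Fin.cons_zero, Fin.cons_succ]
    have h0 : 0 ≤ p i * (∏ k, p (w k)) * (p j * ∏ k, p (v k)) :=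
      mul_nonneg (mul_nonneg (hp0 i) (hP w)) (mul_nonneg (hp0 j) (hP v))
    by_cases hij : i = j
    · subst hij
      have hset : {t | ‖wordPoint T (n + 1) (Fin.cons i w) t -
          wordPoint T (n + 1) (Fin.cons i v) t‖ ≤ r} =
          {t | ‖wordPoint T n w t - wordPoint T n v t‖ ≤ r / c i} := by
        ext t
        simp only [mem_ofPred_eq, wordPoint_succ, Fin.cons_zero, Fin.tail_cons,
          add_sub_add_left_eq_sub]
        rw [← map_sub, hT, le_div_iff₀ (hc i), mul_comm]
      rw [hset, if_pos rfl]
      have := mul_nonneg h0 hD0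
      nlinarith
    · rw [if_neg hij, add_zero]
      exact mul_le_mul_of_nonneg_left (hD _ _ (by simpa using hij)) h0
  have h1 : wordEnergy T p ν (n + 1) r ≤ ∑ i, ∑ w : Fin n → Fin N, ∑ j, ∑ v : Fin n → Fin N,
      (p i * (∏ k, p (w k)) * (p j * ∏ k, p (v k)) * D + if i = j then
        p i ^ 2 * ((∏ k, p (w k)) * (∏ k, p (v k)) *
          ν.real {t | ‖wordPoint T n w t - wordPoint T n v t‖ ≤ r / c i}) else 0) := by
    rw [wordEnergy, sum_words_succ]
    refine Finset.sum_le_sum fun i _ => Finset.sum_le_sum fun w _ => ?_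
    rw [sum_words_succ]
    exact Finset.sum_le_sum fun j _ => Finset.sum_le_sum fun v _ => hterm i w j v
  refine h1.trans_eq ?_
  have hone : ∑ i, ∑ w : Fin n → Fin N, p i * (∏ k, p (w k)) = 1 := by
    simp only [← Finset.mul_sum, sum_prod_words hp, mul_one, hp]
  simp only [Finset.sum_add_distrib]
  congr 1
  · simp only [← Finset.sum_mul, ← Finset.mul_sum, sum_prod_words hp, hp, mul_one, one_mul]
  · refine Finset.sum_congr rfl fun i _ => ?_
    rw [wordEnergy, Finset.mul_sum]
    refine Finset.sum_congr rfl fun w _ => ?_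
    rw [Finset.sum_eq_single i (fun j _ hj => by simp [hj.symm]) (by simp), Finset.mul_sum]
    simp

/-- With `p i = c i ^ s` and `m ≤ s`, `p i ^ 2 * (r / c i) ^ m ≤ p i * r ^ m`, and the `p i` sum to
`1`. Each extra letter thus adds just one `D * r ^ m`, whence the factor `n`; the last term comes
from pairs never separated. -/
theorem wordEnergy_le {T : Fin N → E →ₗ[ℝ] E} {c : Fin N → ℝ} (hc : ∀ i, 0 < c i)
    {a : ℝ} (ha0 : 0 < a) (hca : ∀ i, c i ≤ a) (ha1 : a ≤ 1)
    (hT : ∀ i x, ‖T i x‖ = c i * ‖x‖) {s m : ℝ} (hs : ∑ i, c i ^ s = 1) (hm0 : 0 ≤ m)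
    (hms : m ≤ s) {ν : Measure (Fin N → E)} [IsFiniteMeasure ν] {D : ℝ} (hD0 : 0 ≤ D)
    (hD : ∀ (n : ℕ) (w v : Fin (n + 1) → Fin N), w 0 ≠ v 0 → ∀ r : ℝ, 0 < r →
      ν.real {t | ‖wordPoint T (n + 1) w t - wordPoint T (n + 1) v t‖ ≤ r} ≤ D * r ^ m)
    (n : ℕ) {r : ℝ} (hr : 0 < r) :
    wordEnergy T (fun i => c i ^ s) ν n r ≤ n * D * r ^ m + ν.real univ * (a ^ n) ^ m := by
  have hp0 : ∀ i, 0 ≤ c i ^ s := fun i => Real.rpow_nonneg (hc i).le s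
  have hpm : ∀ i, c i ^ s ≤ c i ^ m := fun i =>
    Real.rpow_le_rpow_of_exponent_ge (hc i) ((hca i).trans ha1) hms
  induction n generalizing r with
  | zero =>
    simp only [wordEnergy, Finset.univ_unique, Finset.sum_singleton, Finset.univ_eq_empty,
      Finset.prod_empty, Nat.cast_zero, zero_mul, zero_add, pow_zero, Real.one_rpow, mul_one,
      one_mul]
    exact measureReal_mono (subset_univ _)
  | succ n ih =>
    refine (wordEnergy_succ_le hc hT hp0 hs (mul_nonneg hD0 (Real.rpow_nonneg hr.le m))
      fun w v h => hD n w v h r hr).trans ?_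
    have hterm : ∀ i, (c i ^ s) ^ 2 * wordEnergy T (fun i => c i ^ s) ν n (r / c i) ≤
        c i ^ s * (n * D * r ^ m + ν.real univ * (a ^ (n + 1)) ^ m) := by
      intro i
      rw [sq, mul_assoc]
      refine mul_le_mul_of_nonneg_left ?_ (hp0 i)
      have h1 := ih (div_pos hr (hc i))
      rw [Real.div_rpow hr.le (hc i).le] at h1
      have hcm : 0 < c i ^ m := Real.rpow_pos_of_pos (hc i) m
      have hX : 0 ≤ n * D * (r ^ m / c i ^ m) + ν.real univ * (a ^ n) ^ m := by positivity
      calc c i ^ s * _ ≤ c i ^ m * (n * D * (r ^ m / c i ^ m) + ν.real univ * (a ^ n) ^ m) :=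
            (mul_le_mul_of_nonneg_left h1 (hp0 i)).trans (mul_le_mul_of_nonneg_right (hpm i) hX)
        _ = n * D * r ^ m + ν.real univ * (c i ^ m * (a ^ n) ^ m) := by field_simp
        _ ≤ _ := by
          rw [pow_succ' a n, Real.mul_rpow ha0.le (by positivity)]
          gcongr
          · exact (hc i).le
          · exact hca i
    refine (add_le_add_right (Finset.sum_le_sum fun i _ => hterm i) _).trans_eq ?_
    rw [← Finset.sum_mul, hs]
    push_cast
    ring

end Energy

/-! ### From mean to almost sure collision bounds. -/

section Collision

variable {E : Type*} [NormedAddCommGroup E] [NormedSpace ℝ E] {N : ℕ}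

/-- The collision probability at scale `r` of the random points `x_w(t)`. -/
noncomputable def collisionProb (T : Fin N → E →ₗ[ℝ] E) (p : Fin N → ℝ) (n : ℕ) (r : ℝ)
    (t : Fin N → E) : ℝ :=
  ∑ w : Fin n → Fin N, ∑ v : Fin n → Fin N,
    {t | ‖wordPoint T n w t - wordPoint T n v t‖ ≤ r}.indicator
      (fun _ => (∏ k, p (w k)) * ∏ k, p (v k)) t

theorem collisionProb_nonneg (T : Fin N → E →ₗ[ℝ] E) {p : Fin N → ℝ} (hp0 : ∀ i, 0 ≤ p i) (n : ℕ)
    (r : ℝ) (t : Fin N → E) : 0 ≤ collisionProb T p n r t :=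
  Finset.sum_nonneg fun _ _ => Finset.sum_nonneg fun _ _ => indicator_nonneg (fun _ _ =>
    mul_nonneg (Finset.prod_nonneg fun _ _ => hp0 _) (Finset.prod_nonneg fun _ _ => hp0 _)) t

theorem integrable_collisionProb_and_integral_eq [FiniteDimensional ℝ E] [MeasurableSpace E]
    [BorelSpace E] (T : Fin N → E →ₗ[ℝ] E) (p : Fin N → ℝ)
    (ν : Measure (Fin N → E)) [IsFiniteMeasure ν] (n : ℕ) (r : ℝ) :
    Integrable (collisionProb T p n r) ν ∧
      ∫ t, collisionProb T p n r t ∂ν = wordEnergy T p ν n r := by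
  have hA : ∀ w v, MeasurableSet {t | ‖wordPoint T n w t - wordPoint T n v t‖ ≤ r} := fun w v =>
    (isClosed_le ((wordPoint T n w).continuous_of_finiteDimensional.sub
      (wordPoint T n v).continuous_of_finiteDimensional).norm continuous_const).measurableSet
  have hint : ∀ w v, Integrable ({t | ‖wordPoint T n w t - wordPoint T n v t‖ ≤ r}.indicator
      (fun _ => (∏ k, p (w k)) * ∏ k, p (v k))) ν := fun w v =>
    (integrable_const _).indicator (hA w v)
  refine ⟨integrable_finsetSum _ fun w _ => integrable_finsetSum _ fun v _ => hint w v, ?_⟩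
  unfold collisionProb
  rw [integral_finsetSum _ fun w _ => integrable_finsetSum _ fun v _ => hint w v]
  refine Finset.sum_congr rfl fun w _ => ?_
  rw [integral_finsetSum _ fun v _ => hint w v]
  refine Finset.sum_congr rfl fun v _ => ?_
  rw [integral_indicator_const _ (hA w v), smul_eq_mul, mul_comm]

/-- Borel–Cantelli in integral form: `∑ f n` has finite integral, so it converges almost everywhere
and its terms tend to `0`. -/
theorem ae_eventually_lt_one_of_summable_integral {Ω : Type*} [MeasurableSpace Ω] {ν : Measure Ω}
    {f : ℕ → Ω → ℝ} {g : ℕ → ℝ} (hf0 : ∀ n t, 0 ≤ f n t) (hf : ∀ n, Integrable (f n) ν)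
    (hfg : ∀ n, ∫ t, f n t ∂ν ≤ g n) (hg : Summable g) :
    ∀ᵐ t ∂ν, ∀ᶠ n in atTop, f n t < 1 := by
  have hmeas := fun n => (hf n).aestronglyMeasurable.aemeasurable.ennreal_ofReal
  have hfin : ∫⁻ t, ∑' n, ENNReal.ofReal (f n t) ∂ν ≠ ⊤ := by
    rw [lintegral_tsum hmeas]
    refine ne_top_of_le_ne_top hg.tsum_ofReal_ne_top (ENNReal.tsum_le_tsum fun n => ?_)
    rw [← ofReal_integral_eq_lintegral_ofReal (hf n) (ae_of_all _ (hf0 n))]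
    exact ENNReal.ofReal_le_ofReal (hfg n)
  filter_upwards [ae_lt_top' (AEMeasurable.tsum hmeas) hfin] with t ht
  filter_upwards [(ENNReal.tendsto_atTop_zero_of_tsum_ne_top ht.ne).eventually
    (gt_mem_nhds zero_lt_one)] with n hn
  rwa [ENNReal.ofReal_lt_one] at hn

end Collision

/-! ### Almost sure lower bound for the dimension. -/

section LowerBound

variable {E : Type*} [NormedAddCommGroup E] [NormedSpace ℝ E] [FiniteDimensional ℝ E]
  [MeasureSpace E] [BorelSpace E] [(volume : Measure E).IsAddHaarMeasure] {N : ℕ}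

/-- Here `a < 1 / 2` makes the transversality constant `1 - a / (1 - a)` positive. The slab estimate
gives exponent `finrank ℝ E`, weakened to `m` for `r ≤ 1`; for `r > 1` the total mass suffices. -/
theorem exists_measureReal_wordPoint_sub_le {T : Fin N → E →ₗ[ℝ] E} {a : ℝ} (ha0 : 0 ≤ a)
    (ha1 : a < 1 / 2) (hT : ∀ i x, ‖T i x‖ ≤ a * ‖x‖) {m : ℝ} (hm0 : 0 ≤ m)
    (hm : m ≤ Module.finrank ℝ E) (R : ℝ) :
    ∃ D : ℝ, 0 ≤ D ∧ ∀ (n : ℕ) (w v : Fin (n + 1) → Fin N), w 0 ≠ v 0 → ∀ r : ℝ, 0 < r →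
      (volume.restrict (Metric.closedBall (0 : Fin N → E) R)).real
        {t | ‖wordPoint T (n + 1) w t - wordPoint T (n + 1) v t‖ ≤ r} ≤ D * r ^ m := by
  have hε : 0 < 1 - a / (1 - a) := by
    rw [sub_pos, div_lt_one (by linarith)]
    linarith
  obtain ⟨C, hC0, hC⟩ := exists_volume_slab_le (E := E) N R hε
  set ν := volume.restrict (Metric.closedBall (0 : Fin N → E) R)
  have : IsFiniteMeasure ν := ⟨by
    rw [Measure.restrict_apply_univ]; exact (isCompact_closedBall _ _).measure_lt_top⟩
  refine ⟨max C (ν.real univ), le_max_of_le_left hC0, fun n w v hwv r hr => ?_⟩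
  obtain ⟨i, hi⟩ := exists_norm_le_wordPoint_single ha0 (by linarith) hT hwv
  rcases le_or_gt r 1 with h | h
  · refine (hC _ i hi r hr.le).trans (mul_le_mul (le_max_left _ _) ?_ (by positivity)
      (le_max_of_le_left hC0))
    rw [← Real.rpow_natCast]
    exact Real.rpow_le_rpow_of_exponent_ge hr h hm
  · exact (measureReal_mono (subset_univ _)).trans ((le_max_right C _).trans
      (le_mul_of_one_le_right (le_max_of_le_left hC0) (Real.one_le_rpow h.le hm0)))

theorem summable_nat_mul_geometric_add_geometric {ρ : ℝ} (h0 : 0 ≤ ρ) (h1 : ρ < 1) (A B : ℝ) :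
    Summable fun n : ℕ => (n * ρ ^ n) * A + ρ ^ n * B := by
  have h := summable_pow_mul_geometric_of_norm_lt_one 1 (by rwa [Real.norm_of_nonneg h0] : ‖ρ‖ < 1)
  simp only [pow_one] at h
  exact (h.mul_right A).add ((summable_geometric_of_lt_one h0 h1).mul_right B)

/-- Divided by `(a ^ n) ^ η`, the collision probability has mean `O(n * ρ ^ n)` with `ρ = a ^ (m -
η) < 1`, which is summable. -/
theorem ae_eventually_collisionProb_le_of_measureReal_le {T : Fin N → E →ₗ[ℝ] E} {c : Fin N → ℝ}
    (hc : ∀ i, 0 < c i) {a : ℝ} (ha0 : 0 < a) (hca : ∀ i, c i ≤ a) (ha1 : a < 1)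
    (hT : ∀ i x, ‖T i x‖ = c i * ‖x‖) {s m η : ℝ} (hs : ∑ i, c i ^ s = 1) (hm0 : 0 ≤ m)
    (hms : m ≤ s) (hη : η < m) {ν : Measure (Fin N → E)} [IsFiniteMeasure ν] {D : ℝ} (hD0 : 0 ≤ D)
    (hD : ∀ (n : ℕ) (w v : Fin (n + 1) → Fin N), w 0 ≠ v 0 → ∀ r : ℝ, 0 < r →
      ν.real {t | ‖wordPoint T (n + 1) w t - wordPoint T (n + 1) v t‖ ≤ r} ≤ D * r ^ m)
    {K : ℝ} (hK : 0 < K) :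
    ∀ᵐ t ∂ν, ∀ᶠ n : ℕ in atTop,
      collisionProb T (fun i => c i ^ s) n (K * a ^ n) t ≤ (a ^ n) ^ η := by
  have hρ0 : 0 < a ^ (m - η) := Real.rpow_pos_of_pos ha0 _
  have hρ1 : a ^ (m - η) < 1 := Real.rpow_lt_one ha0.le ha1 (by linarith)
  have hbound : ∀ n, ∫ t, collisionProb T (fun i => c i ^ s) n (K * a ^ n) t *
      (a ^ n) ^ (-η) ∂ν ≤
      (n * (a ^ (m - η)) ^ n) * (D * K ^ m) + (a ^ (m - η)) ^ n * ν.real univ := by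
    intro n
    have han : 0 < a ^ n := pow_pos ha0 n
    rw [integral_mul_const, (integrable_collisionProb_and_integral_eq _ _ _ _ _).2]
    have h1 := wordEnergy_le hc ha0 hca ha1.le hT hs hm0 hms hD0 hD n (mul_pos hK han)
    refine (mul_le_mul_of_nonneg_right h1 (Real.rpow_nonneg han.le _)).trans_eq ?_
    have h2 : (a ^ (m - η)) ^ n = (a ^ n) ^ m * (a ^ n) ^ (-η) := by
      rw [← Real.rpow_add han, ← sub_eq_add_neg, ← Real.rpow_natCast, ← Real.rpow_natCast,
        ← Real.rpow_mul ha0.le, ← Real.rpow_mul ha0.le, mul_comm]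
    rw [h2, Real.mul_rpow hK.le han.le]
    generalize (a ^ n) ^ m = x, (a ^ n) ^ (-η) = y
    ring
  have hsum : Summable fun n : ℕ =>
      (n * (a ^ (m - η)) ^ n) * (D * K ^ m) + (a ^ (m - η)) ^ n * ν.real univ :=
    summable_nat_mul_geometric_add_geometric hρ0.le hρ1 _ _
  have hae := ae_eventually_lt_one_of_summable_integral (ν := ν)
    (f := fun n t => collisionProb T (fun i => c i ^ s) n (K * a ^ n) t * (a ^ n) ^ (-η))
    (fun n t => mul_nonneg (collisionProb_nonneg T (fun i => Real.rpow_nonneg (hc i).le s) n _ t)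
      (Real.rpow_nonneg (pow_pos ha0 n).le (-η)))
    (fun n => (integrable_collisionProb_and_integral_eq T _ ν n _).1.mul_const _) hbound hsum
  filter_upwards [hae] with t ht
  filter_upwards [ht] with n hn
  have han : 0 < a ^ n := pow_pos ha0 n
  rw [Real.rpow_neg han.le, ← div_eq_mul_inv, div_lt_one (Real.rpow_pos_of_pos han _)] at hn
  exact hn.le

/-- Almost surely the collision probability at scale `K * a ^ n` is `O(a ^ (n * η))`. -/
theorem ae_eventually_collisionProb_le {T : Fin N → E →ₗ[ℝ] E} {c : Fin N → ℝ}
    (hc : ∀ i, 0 < c i) {a : ℝ} (ha0 : 0 < a) (hca : ∀ i, c i ≤ a) (ha1 : a < 1 / 2)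
    (hT : ∀ i x, ‖T i x‖ = c i * ‖x‖) {s m η : ℝ} (hs : ∑ i, c i ^ s = 1) (hm0 : 0 ≤ m)
    (hms : m ≤ s) (hm : m ≤ Module.finrank ℝ E) (hη : η < m) (R : ℝ) {K : ℝ} (hK : 0 < K) :
    ∀ᵐ t ∂volume.restrict (Metric.closedBall (0 : Fin N → E) R), ∀ᶠ n : ℕ in atTop,
      collisionProb T (fun i => c i ^ s) n (K * a ^ n) t ≤ (a ^ n) ^ η := by
  obtain ⟨D, hD0, hD⟩ := exists_measureReal_wordPoint_sub_le ha0.le ha1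
    (fun i x => (hT i x).trans_le (mul_le_mul_of_nonneg_right (hca i) (norm_nonneg x))) hm0 hm R
  have : IsFiniteMeasure (volume.restrict (Metric.closedBall (0 : Fin N → E) R)) := ⟨by
    rw [Measure.restrict_apply_univ]; exact (isCompact_closedBall _ _).measure_lt_top⟩
  exact ae_eventually_collisionProb_le_of_measureReal_le hc ha0 hca (by linarith) hT hs hm0 hms hη
    hD0 hD hK

/-- Words whose nearby points of `F` share a covering set of diameter `a ^ n` have word points
within `(1 + 2 * ‖y‖) * a ^ n`, so they collide. Counting then forces at least `(a ^ n) ^ (-η)`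
sets; for a limsup the scales `a ^ n` are enough. -/
theorem le_upperBoxDim_of_eventually_collisionProb_le {E : Type*} [NormedAddCommGroup E]
    [NormedSpace ℝ E] {T : Fin N → E →ₗ[ℝ] E} {p : Fin N → ℝ} (hp0 : ∀ i, 0 ≤ p i)
    (hp : ∑ i, p i = 1) {a : ℝ} (ha0 : 0 < a) (ha1 : a < 1) (hT : ∀ i x, ‖T i x‖ ≤ a * ‖x‖)
    {t : Fin N → E} {F : Set E} (hFS : ∀ i, ∀ x ∈ F, T i x + t i ∈ F) {y : E} (hy : y ∈ F)
    {K η : ℝ} (hK : 1 + 2 * ‖y‖ ≤ K)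
    (h : ∀ᶠ n : ℕ in atTop, collisionProb T p n (K * a ^ n) t ≤ (a ^ n) ^ η) :
    (η : EReal) ≤ upperBoxDim F := by
  have htend : Tendsto (fun n : ℕ => a ^ n) atTop (𝓝[>] 0) :=
    tendsto_nhdsWithin_iff.2 ⟨tendsto_pow_atTop_nhds_zero_of_lt_one ha0.le ha1,
      Eventually.of_forall fun n => pow_pos ha0 n⟩
  refine le_limsup_of_frequently_le (htend.frequently ?_) (by isBoundedDefault)
  refine Eventually.frequently ?_
  filter_upwards [h, eventually_gt_atTop 0] with n hn hn0
  have han : 0 < a ^ n := pow_pos ha0 n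
  have han1 : a ^ n < 1 := pow_lt_one₀ ha0.le ha1 hn0.ne'
  have hlog : 0 < -Real.log (a ^ n) := neg_pos.2 (Real.log_neg han han1)
  rw [EReal.le_div_iff_mul_le (by exact_mod_cast hlog) (EReal.coe_ne_top _), ← EReal.coe_mul,
    show η * -Real.log (a ^ n) = -η * Real.log (a ^ n) by ring, ← Real.log_rpow han,
    ← ENNReal.log_ofReal_of_pos (Real.rpow_pos_of_pos han _), ENNReal.log_le_log_iff]
  obtain ⟨𝒰, h1, h2, h3⟩ := exists_encard_eq_boxCoveringNumber (a ^ n) F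
  rw [← h3]
  rcases 𝒰.finite_or_infinite with hfin | hinf
  swap
  · simp [hinf.encard_eq]
  rw [← hfin.cast_ncard_eq, ENat.toENNReal_coe, ← ENNReal.ofReal_natCast]
  refine ENNReal.ofReal_le_ofReal ?_
  choose z hzF hz using fun w : Fin n → Fin N => exists_norm_sub_wordPoint_le ha0.le hT hFS hy w
  choose f hf𝒰 hf using fun w => h1 (hzF w)
  have hP : ∀ w : Fin n → Fin N, 0 ≤ ∏ k, p (w k) := fun w => Finset.prod_nonneg fun k _ => hp0 _
  have hcs : 1 ≤ (𝒰.ncard : ℝ) * collisionProb T p n (K * a ^ n) t :=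
    one_le_ncard_mul_sum hfin hf𝒰 (sum_prod_words hp n)
    (Q := fun w v => {t | ‖wordPoint T n w t - wordPoint T n v t‖ ≤ K * a ^ n}.indicator
          (fun _ => (∏ k, p (w k)) * ∏ k, p (v k)) t)
    (fun w v => indicator_nonneg (fun _ _ => mul_nonneg (hP w) (hP v)) t) (by
      intro w v hwv
      rw [indicator_of_mem]
      have hd : ‖z w - z v‖ ≤ a ^ n := by
        have := Metric.edist_le_of_ediam_le (hf w) (hwv ▸ hf v) (h2 _ (hf𝒰 w))
        rwa [edist_dist, ENNReal.ofReal_le_ofReal_iff han.le, dist_eq_norm] at this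
      have htri : ‖wordPoint T n w t - wordPoint T n v t‖ ≤
          ‖z w - z v‖ + ‖z w - wordPoint T n w t‖ + ‖z v - wordPoint T n v t‖ := by
        calc _ = ‖(z w - z v) - (z w - wordPoint T n w t) + (z v - wordPoint T n v t)‖ := by
              congr 1; abel
          _ ≤ _ := (norm_add_le _ _).trans (by gcongr; exact norm_sub_le _ _)
      have := hz w
      have := hz v
      have := mul_le_mul_of_nonneg_right hK han.le
      change ‖wordPoint T n w t - wordPoint T n v t‖ ≤ K * a ^ n
      linarith)
  have hle := hcs.trans (mul_le_mul_of_nonneg_left hn (Nat.cast_nonneg _))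
  rw [Real.rpow_neg han.le, inv_eq_one_div, div_le_iff₀ (Real.rpow_pos_of_pos han _)]
  exact hle

/-- For almost every translation vector the upper box dimension of the self-similar set is at least
the minimum of the similarity dimension and the dimension of the space. -/
theorem ae_le_upperBoxDim {T : Fin N → E →ₗ[ℝ] E} {c : Fin N → ℝ} (hc : ∀ i, 0 < c i)
    {a : ℝ} (ha0 : 0 < a) (hca : ∀ i, c i ≤ a) (ha1 : a < 1 / 2)
    (hT : ∀ i x, ‖T i x‖ = c i * ‖x‖) {s m : ℝ} (hs : ∑ i, c i ^ s = 1) (hm0 : 0 ≤ m)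
    (hms : m ≤ s) (hm : m ≤ Module.finrank ℝ E) :
    ∀ᵐ t : Fin N → E, ∀ F : Set E, F.Nonempty → (∀ i, ∀ x ∈ F, T i x + t i ∈ F) →
      (m : EReal) ≤ upperBoxDim F := by
  have hTa : ∀ i x, ‖T i x‖ ≤ a * ‖x‖ := fun i x =>
    (hT i x).trans_le (mul_le_mul_of_nonneg_right (hca i) (norm_nonneg x))
  -- Natural-number parameters keep the exceptional sets countable in number: `R` bounds `‖t‖`, `K`
  -- bounds `2 * ‖y‖`, and `η = m - 1 / (k + 1)` tends to `m`. The resulting null set does not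
  -- depend on `F`.
  have hae := fun R K k : ℕ => (ae_restrict_iff' Metric.isClosed_closedBall.measurableSet).1
    (ae_eventually_collisionProb_le hc ha0 hca ha1 hT hs hm0 hms hm
    (sub_lt_self m (Nat.one_div_pos_of_nat (α := ℝ) (n := k))) R (K := K + 1) (by positivity))
  simp only [← ae_all_iff] at hae
  filter_upwards [hae] with t ht F hF hFS
  obtain ⟨y, hy⟩ := hF
  obtain ⟨R, hR⟩ := exists_nat_ge ‖t‖
  obtain ⟨K, hK⟩ := exists_nat_ge (2 * ‖y‖)
  refine EReal.ge_of_forall_gt_iff_ge.1 fun z hz => ?_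
  obtain ⟨k, hk⟩ := exists_nat_one_div_lt (sub_pos.2 (show z < m by exact_mod_cast hz))
  refine le_trans (b := ((m - 1 / ((k : ℝ) + 1) : ℝ) : EReal)) ?_
    (le_upperBoxDim_of_eventually_collisionProb_le (fun i => Real.rpow_nonneg (hc i).le s) hs ha0
    (by linarith) hTa hFS hy (K := K + 1) (by linarith)
    (ht R K k (mem_closedBall_zero_iff.2 hR)))
  exact_mod_cast (by linarith : z ≤ m - 1 / ((k : ℝ) + 1))

end LowerBound

/-! ### Similarity dimension and the conclusion. -/

theorem exists_similarityDimension {N : ℕ} (hN : 1 ≤ N) {c : Fin N → ℝ} (hc0 : ∀ i, 0 < c i)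
    (hc1 : ∀ i, c i < 1) : ∃ s : ℝ, 0 ≤ s ∧ ∑ i, c i ^ s = 1 := by
  have hcont : Continuous fun s : ℝ => ∑ i, c i ^ s :=
    continuous_finsetSum _ fun i _ => continuous_const.rpow continuous_id fun _ =>
      Or.inl (hc0 i).ne'
  have hlim : Tendsto (fun s : ℝ => ∑ i, c i ^ s) atTop (𝓝 (∑ _ : Fin N, (0 : ℝ))) :=
    tendsto_finsetSum _ fun i _ => tendsto_rpow_atTop_of_base_lt_one (c i)
      (by linarith [hc0 i]) (hc1 i)
  rw [Finset.sum_const_zero] at hlim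
  obtain ⟨b, hb, hb0⟩ := ((hlim.eventually (gt_mem_nhds zero_lt_one)).and
    (eventually_ge_atTop 0)).exists
  obtain ⟨s, hs, hs1⟩ := intermediate_value_Icc' hb0 hcont.continuousOn
    ⟨hb.le, by simpa using (by exact_mod_cast hN : (1 : ℝ) ≤ N)⟩
  exact ⟨s, hs.1, hs1⟩

theorem corollary2p3 (d N : ℕ) (hN : 1 ≤ N)
    (T : Fin N → EuclideanSpace ℝ (Fin d) →ₗ[ℝ] EuclideanSpace ℝ (Fin d)) (c : Fin N → ℝ)
    (hT : ∀ i, IsContractingSimilarity (T i) (c i)) (hc : ∀ i, c i < 1 / 2)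
    (C : Set (EuclideanSpace ℝ (Fin d))) (hC : IsCompact C) (hC' : C.Nonempty) :
    (∀ t : Fin N → EuclideanSpace ℝ (Fin d),
      (∃! F, IsAttractor (fun i x => T i x + t i) ∅ F) ∧
      (∃! F, IsAttractor (fun i x => T i x + t i) C F)) ∧
    ∀ᵐ t : Fin N → EuclideanSpace ℝ (Fin d) ∂volume, ∀ F₀ F : Set (EuclideanSpace ℝ (Fin d)),
      IsAttractor (fun i x => T i x + t i) ∅ F₀ →
      IsAttractor (fun i x => T i x + t i) C F →
      upperBoxDim F = max (upperBoxDim F₀) (upperBoxDim C) := by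
  have : NeZero N := ⟨by omega⟩
  obtain ⟨i₀, hi₀⟩ := Finite.exists_max c
  set a := c i₀
  have ha0 : 0 < a := (hT i₀).1
  have ha1 : a < 1 / 2 := hc i₀
  have hc0 : ∀ i, 0 < c i := fun i => (hT i).1
  have hc1 : ∀ i, c i < 1 := fun i => (hT i).2.1
  have hdist : ∀ (t : Fin N → EuclideanSpace ℝ (Fin d)) i x y,
      dist (T i x + t i) (T i y + t i) ≤ c i * dist x y := fun t i x y => by
    rw [dist_add_right]
    exact ((hT i).2.2 x y).le
  have hdist' : ∀ (t : Fin N → EuclideanSpace ℝ (Fin d)) i x y,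
      dist (T i x + t i) (T i y + t i) ≤ a * dist x y := fun t i x y =>
    (hdist t i x y).trans (mul_le_mul_of_nonneg_right (hi₀ i) dist_nonneg)
  refine ⟨fun t => ⟨existsUnique_isAttractor ha0.le (by linarith) (hdist' t) isCompact_empty,
    existsUnique_isAttractor ha0.le (by linarith) (hdist' t) hC⟩, ?_⟩
  obtain ⟨s, hs0, hs⟩ := exists_similarityDimension hN hc0 hc1
  have hnorm : ∀ i x, ‖T i x‖ = c i * ‖x‖ := fun i x => by
    simpa [dist_eq_norm] using (hT i).2.2 x 0
  filter_upwards [ae_le_upperBoxDim hc0 ha0 hi₀ ha1 hnorm hs (m := min s d)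
    (le_min hs0 (Nat.cast_nonneg d)) (min_le_left _ _) (by simp)] with t ht F₀ F hF₀ hF
  have hFS : ∀ i, ∀ x ∈ F, T i x + t i ∈ F := fun i x hx =>
    hF.2.2.symm.subset (Or.inl (mem_iUnion.2 ⟨i, x, hx, rfl⟩))
  have hFS₀ : ∀ i, ∀ x ∈ F₀, T i x + t i ∈ F₀ := fun i x hx =>
    hF₀.2.2.symm.subset (Or.inl (mem_iUnion.2 ⟨i, x, hx, rfl⟩))
  have hm := ht F₀ hF₀.1 hFS₀
  apply le_antisymm
  -- If `s ≤ d`, any `u` above the maximum exceeds `s`, so `∑ c i ^ u < 1` and the covering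
  -- recursion applies. If `d ≤ s`, then `F₀` already has dimension at least `d`.
  · rcases le_total s d with hsd | hsd
    · rw [min_eq_left hsd] at hm
      refine EReal.le_of_forall_lt_iff_le.1 fun u hu => ?_
      obtain ⟨h1, h2⟩ := max_lt_iff.1 hu
      have hsu : s < u := by exact_mod_cast hm.trans_lt h1
      refine upperBoxDim_le_of_subset_iUnion hc0 hc1 (hdist t) hF.2.1.totallyBounded
        hC.totallyBounded hF.2.2.subset (hs0.trans hsu.le) ?_ h2
      rw [← hs]
      exact Finset.sum_lt_sum_of_nonempty ⟨i₀, Finset.mem_univ _⟩ fun i _ =>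
        Real.rpow_lt_rpow_of_exponent_gt (hc0 i) (hc1 i) hsu
    · rw [min_eq_right hsd] at hm
      exact (upperBoxDim_le_of_isBounded hF.2.1.isBounded).trans (hm.trans (le_max_left _ _))
  · refine max_le (upperBoxDim_mono ?_) (upperBoxDim_mono ?_)
    · refine subset_of_subset_hutchinson ha0.le (by linarith) (hdist' t) hF₀.2.1 hF₀.2.2.subset
        hF.2.1.isClosed hF.1 ?_
      rw [union_empty]
      exact iUnion_subset fun i => image_subset_iff.2 (hFS i)
    · exact subset_union_right.trans hF.2.2.symm.subset
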